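/- Let $n\ge 1$, let $\Omega\subset\mathbb R^n$ be an open set, and let $\gamma:\mathbb R^n\to\mathbb R$ be measurable with $0<\underline\gamma\le\gamma(x)\le\overline\gamma<\infty$ for a.e. $x\in\mathbb R^n$, for some constants $\underline\gamma,\overline\gamma$. Put $m:=\gamma^{1/2}-1$ and assume that $m\in W^{2,\,n/(2s_0)}_c(\Omega)$ for some $s_0\in(0,1)$ with $2s_0<n$, where for $1<p<\infty$ the set $W^{2,p}_c(\Omega)$ consists of the elements of $W^{2,p}(\mathbb R^n)$ that can be approximated in the Sobolev norm by functions of $C^\infty_c(\Omega)$. For $s\in(0,1)$ let $\mathcal C_{n,s}=\frac{4^s\,\Gamma(n/2+s)}{\pi^{n/2}|\Gamma(-s)|}$, let $$\nabla^s u(x,y)=-\frac{\mathcal C_{n,s}^{1/2}}{\sqrt2}\,\frac{u(y)-u(x)}{|y-x|^{n/2+s+1}}\,(y-x)$$ be the fractional gradient, let the fractional divergence $(\nabla\cdot)^s$ be given by $\langle(\nabla\cdot)^s v,\varphi\rangle=\langle v,\nabla^s\varphi\rangle_{L^2(\mathbb R^{2n})}$ (bilinear pairing) for $v\in L^2(\mathbb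 R^{2n};\mathbb C^n)$, let $\Theta(x,y)=\gamma(x)^{1/2}\gamma(y)^{1/2}\,\mathrm{Id}$, and let $\mathrm C^s_\gamma u=(\nabla\cdot)^s(\Theta\cdot\nabla^s u)$ be the non-local conductivity operator (a non-negative operator, equal to $(-\Delta)^s$ when $\gamma\equiv1$). Then, for every (real- or complex-valued) $u\in H^2(\mathbb R^n)$, one has $\Theta\cdot\nabla^s u\in L^2(\mathbb R^{2n})$ and $\nabla^s\varphi\in L^2(\mathbb R^{2n})$ for all $s\in(0,1)$ and $\varphi\in C^\infty_c(\mathbb R^n)$, so that $\mathrm C^s_\gamma u$ is well defined; the weak gradient $\nabla u$ exists and lies in $L^2(\mathbb R^n)$; and $$\lim_{s\to1^-}\mathrm C^s_\gamma u=-\nabla\cdot(\gamma\nabla u)$$ in the sense of distributions, that is, $$\lim_{s\to1^-}\langle\Theta\cdot\nabla^s u,\nabla^s\varphi\rangle_{L^2(\mathbb R^{2n})}=\int_{\mathbb R^n}\gamma\,\nabla u\cdot\nabla\varphi\,dx\qquad\text{for all }\varphi\in C^\infty_c(\mathbb R^n).$$ -/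

import Mathlib

open MeasureTheory TemperedDistribution Filter Topology
open scoped ENNReal SchwartzMap Distributions

noncomputable section

namespace FracCond

/-- Euclidean space `ℝⁿ`. -/
abbrev Rn (n : ℕ) : Type := EuclideanSpace ℝ (Fin n)

/-- Vectors of `ℂⁿ`, the values of gradients of complex-valued functions on `ℝⁿ`. -/
abbrev Cn (n : ℕ) : Type := EuclideanSpace ℂ (Fin n)

/-- The norm of `f` in the `Lᵖ`-based Sobolev (Bessel potential) space `W^{k,p}(ℝⁿ)`, `k ≥ 0`, that
is the `Lᵖ` norm of the Bessel potential of order `k` of `f`; it is `∞` when `f` is not in `Lᵖ` or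
the Bessel potential of `f` is not (given by) an `Lᵖ` function. -/
def sobolevENorm {n : ℕ} (k : ℝ) (p : ℝ≥0∞) [Fact (1 ≤ p)] (f : Rn n → ℂ) : ℝ≥0∞ :=
  ⨅ (hf : MemLp f p volume) (g : Lp ℂ p (volume : Measure (Rn n)))
    (_ : besselPotential (Rn n) ℂ k (hf.toLp f : 𝓢'(Rn n, ℂ)) = (g : 𝓢'(Rn n, ℂ))), ‖g‖ₑ

/-- `f ∈ W^{k,p}(ℝⁿ)` for `k ≥ 0`. -/
def MemW {n : ℕ} (k : ℝ) (p : ℝ≥0∞) [Fact (1 ≤ p)] (f : Rn n → ℂ) : Prop :=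
  ∃ hf : MemLp f p volume, MemSobolev k p (hf.toLp f : 𝓢'(Rn n, ℂ))

/-- `f ∈ W^{k,p}_c(Ω)`: `f` belongs to `W^{k,p}(ℝⁿ)` and can be approximated in the Sobolev norm by
functions of `C^∞_c(Ω)`. -/
def MemWc {n : ℕ} (Ω : TopologicalSpace.Opens (Rn n)) (k : ℝ) (p : ℝ≥0∞) [Fact (1 ≤ p)]
    (f : Rn n → ℂ) : Prop :=
  MemW k p f ∧
    ∀ ε : ℝ≥0∞, 0 < ε → ∃ φ : 𝓓(Ω, ℂ), sobolevENorm k p (fun x => f x - φ x) < ε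

/-- The constant `C_{n,s} = 4^s Γ(n/2 + s) / (π^{n/2} |Γ(-s)|)`. -/
def fracConst (n : ℕ) (s : ℝ) : ℝ :=
  (4 : ℝ) ^ s * Real.Gamma ((n : ℝ) / 2 + s) /
    (Real.pi ^ ((n : ℝ) / 2) * |Real.Gamma (-s)|)

/-- The fractional gradient
`∇ˢu(x,y) = -(C_{n,s}^{1/2} / √2) (u(y) - u(x)) / |y - x|^{n/2+s+1} (y - x)`
(this pointwise formula also gives, almost everywhere, the continuous extension from `C^∞_c(ℝⁿ)`
to `Hˢ(ℝⁿ)`). -/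
def fracGrad {n : ℕ} (s : ℝ) (u : Rn n → ℂ) (z : Rn n × Rn n) : Cn n :=
  WithLp.toLp 2 fun i =>
    -((Real.sqrt (fracConst n s) / Real.sqrt 2 : ℝ) : ℂ) *
      ((u z.2 - u z.1) / ((‖z.2 - z.1‖ ^ ((n : ℝ) / 2 + s + 1) : ℝ) : ℂ)) *
      ((z.2 i - z.1 i : ℝ) : ℂ)

/-- The fractional divergence of `v : ℝ²ⁿ → ℂⁿ` (square integrable), as the functional
`φ ↦ ⟨v, ∇ˢφ⟩_{L²(ℝ²ⁿ)}`; the pairing is bilinear, as for distributions. -/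
def fracDiv {n : ℕ} (s : ℝ) (v : Rn n × Rn n → Cn n) (φ : Rn n → ℂ) : ℂ :=
  ∫ z : Rn n × Rn n, ∑ i, v z i * fracGrad s φ z i

/-- The interaction matrix `Θ(x,y) = γ(x)^{1/2} γ(y)^{1/2} Id`. -/
def interactionMatrix {n : ℕ} (γ : Rn n → ℝ) (z : Rn n × Rn n) : Matrix (Fin n) (Fin n) ℂ :=
  ((Real.sqrt (γ z.1) * Real.sqrt (γ z.2) : ℝ) : ℂ) • (1 : Matrix (Fin n) (Fin n) ℂ)

/-- The flux `Θ · ∇ˢu`. -/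
def fracFlux {n : ℕ} (s : ℝ) (γ : Rn n → ℝ) (u : Rn n → ℂ) (z : Rn n × Rn n) : Cn n :=
  WithLp.toLp 2 ((interactionMatrix γ z).mulVec (WithLp.ofLp (fracGrad s u z)))

/-- The non-local conductivity operator `C^s_γ u = (∇·)ˢ(Θ · ∇ˢu)`. -/
def fracCond {n : ℕ} (s : ℝ) (γ : Rn n → ℝ) (u : Rn n → ℂ) : (Rn n → ℂ) → ℂ :=
  fracDiv s (fracFlux s γ u)

/-- The partial derivative `∂φ/∂xᵢ`. -/
def partialDeriv {n : ℕ} (i : Fin n) (φ : Rn n → ℂ) (x : Rn n) : ℂ :=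
  fderiv ℝ φ x (EuclideanSpace.single i 1)

/-- `G` is the weak gradient of the locally integrable function `u`. -/
def IsWeakGradient {n : ℕ} (u : Rn n → ℂ) (G : Rn n → Cn n) : Prop :=
  LocallyIntegrable u ∧ LocallyIntegrable G ∧
    ∀ (φ : 𝓓((⊤ : TopologicalSpace.Opens (Rn n)), ℂ)) (i : Fin n),
      ∫ x, u x * partialDeriv i φ x = -∫ x, G x i * φ x

/-- The (local) divergence of a locally integrable vector field `F`, as a distribution:
`⟨∇·F, φ⟩ = -∫ F · ∇φ`. -/
def distDiv {n : ℕ} (F : Rn n → Cn n) (φ : Rn n → ℂ) : ℂ :=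
  -∫ x, ∑ i, F x i * partialDeriv i φ x

end FracCond

end

/-! The shear `(x, y) ↦ (x, y - x)` turns the quadratic form of `C^s_γ` into
`∫ (C_{n,s} / 2) |h|^{-n-2s} I(h) dh` with
`I(h) = ∫ γ(x)^{1/2} γ(x+h)^{1/2} (u(x+h) - u(x)) (φ(x+h) - φ(x)) dx`. Since `C_{n,s}` vanishes to
first order at `s = 1`, the measures `(C_{n,s} / 2) |h|^{2-n-2s} dh` on a ball concentrate at
`h = 0` as `s → 1`, with mass tending to `n`, so only the second order behaviour of `I` at `0`
survives. For `u, φ ∈ H¹` the difference quotients converge in `L²`, and translations are continuous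
in `L²`; hence `I(h) = hᵀ A h + o(|h|²)` with `A = ∫ γ ∇u ⊗ ∇φ`, and by rotation invariance of the
kernel the limit is `tr A = ∫ γ ∇u · ∇φ`. -/

namespace FracCond

noncomputable section

open fwdDiff

section Weight

variable {α 𝕜 F : Type*} [MeasurableSpace α] {μ : Measure α} [NormedField 𝕜]
  [NormedAddCommGroup F] [NormedSpace 𝕜 F] {p : ℝ≥0∞} {a : α → 𝕜} {f : α → F}

theorem memLp_fun_smul (ha : MemLp a ∞ μ) (hf : MemLp f p μ) : MemLp (fun x => a x • f x) p μ :=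
  hf.smul ha

theorem lpNorm_smul_le (ha : MemLp a ∞ μ) (hf : MemLp f p μ) :
    lpNorm (fun x => a x • f x) p μ ≤ lpNorm a ∞ μ * lpNorm f p μ := by
  rw [← toReal_eLpNorm (memLp_fun_smul ha hf).1, ← toReal_eLpNorm ha.1, ← toReal_eLpNorm hf.1,
    ← ENNReal.toReal_mul]
  exact ENNReal.toReal_mono (ENNReal.mul_ne_top ha.2.ne hf.2.ne)
    (eLpNorm_smul_le_eLpNorm_top_mul_eLpNorm p hf.1 a)

end Weight

section Translation

variable {E F : Type*} [AddCommGroup E] [TopologicalSpace E] [IsTopologicalAddGroup E]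
  [MeasurableSpace E] [BorelSpace E] [NormedAddCommGroup F]
  {μ : Measure E} [μ.IsAddLeftInvariant] {p : ℝ≥0∞} {f : E → F}

theorem memLp_comp_add_right (hf : MemLp f p μ) (h : E) : MemLp (fun x => f (x + h)) p μ :=
  hf.comp_measurePreserving (measurePreserving_add_right μ h)

theorem memLp_fwdDiff (hf : MemLp f p μ) (h : E) : MemLp (Δ_[h] f) p μ :=
  (memLp_comp_add_right hf h).sub hf

theorem lpNorm_comp_add_right (hf : MemLp f p μ) (h : E) :
    lpNorm (fun x => f (x + h)) p μ = lpNorm f p μ := by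
  rw [← toReal_eLpNorm hf.1, ← toReal_eLpNorm (memLp_comp_add_right hf h).1]
  exact congrArg _ (eLpNorm_comp_measurePreserving hf.1 (measurePreserving_add_right μ h))

theorem lpNorm_fwdDiff_le_two_mul (hf : MemLp f p μ) (hp : 1 ≤ p) (h : E) :
    lpNorm (Δ_[h] f) p μ ≤ 2 * lpNorm f p μ := by
  have := lpNorm_sub_le (g := f) (memLp_comp_add_right hf h) hp
  rwa [lpNorm_comp_add_right hf, ← two_mul] at this

theorem tendsto_lpNorm_fwdDiff [R1Space E] [IsLocallyFiniteMeasure μ]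
    [μ.InnerRegularCompactLTTop] (hf : MemLp f p μ) (hp : 1 ≤ p) (hp' : p ≠ ∞) :
    Tendsto (fun h => lpNorm (Δ_[h] f) p μ) (𝓝 0) (𝓝 0) := by
  have : Fact (1 ≤ p) := ⟨hp⟩
  have : Fact (p ≠ ∞) := ⟨hp'⟩
  have hcont : Continuous fun h : E => DomAddAct.mk h +ᵥ hf.toLp f :=
    DomAddAct.continuous_mk.vadd continuous_const
  have hlim := tendsto_iff_norm_sub_tendsto_zero.1 (hcont.tendsto 0)
  refine hlim.congr fun h => ?_
  have hh : MemLp (fun x => f (h +ᵥ x)) p μ :=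
    hf.comp_measurePreserving (measurePreserving_vadd h μ)
  rw [DomAddAct.mk_zero, zero_vadd, DomAddAct.mk_vadd_toLp, ← MemLp.toLp_sub hh hf,
    Lp.norm_toLp, toReal_eLpNorm (hh.sub hf).1]
  congr 1
  ext x
  simp [fwdDiff, add_comm]

-- `Δ_[h] a` itself need not tend to `0` in `L^∞`.
theorem tendsto_lpNorm_fwdDiff_smul {𝕜 : Type*} [NormedField 𝕜] [NormedSpace 𝕜 F] [R1Space E]
    [IsLocallyFiniteMeasure μ] [μ.InnerRegularCompactLTTop] {a : E → 𝕜} (ha : MemLp a ∞ μ)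
    (hf : MemLp f p μ) (hp : 1 ≤ p) (hp' : p ≠ ∞) :
    Tendsto (fun h => lpNorm (fun x => Δ_[h] a x • f x) p μ) (𝓝 0) (𝓝 0) := by
  have haf := memLp_fun_smul ha hf
  have hlim := (tendsto_lpNorm_fwdDiff haf hp hp').add
    ((tendsto_lpNorm_fwdDiff hf hp hp').const_mul (lpNorm a ∞ μ))
  rw [mul_zero, add_zero] at hlim
  refine squeeze_zero (fun _ => lpNorm_nonneg) (fun h => ?_) hlim
  have hsplit : (fun x => Δ_[h] a x • f x) =
      Δ_[h] (fun x => a x • f x) - fun x => a (x + h) • Δ_[h] f x := by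
    ext x
    simp only [fwdDiff, Pi.sub_apply, sub_smul, smul_sub]
    abel
  rw [hsplit]
  refine (lpNorm_sub_le (memLp_fwdDiff haf h) hp).trans (add_le_add le_rfl ?_)
  rw [← lpNorm_comp_add_right ha h]
  exact lpNorm_smul_le (memLp_comp_add_right ha h) (memLp_fwdDiff hf h)

end Translation

section Duality

variable {E : Type*} [NormedAddCommGroup E] [InnerProductSpace ℝ E] [FiniteDimensional ℝ E]
  [MeasurableSpace E] [BorelSpace E]

theorem lpNorm_two_le_of_norm_integral_mul_le {f : E → ℂ} (hf : MemLp f 2) {C : ℝ} (hC₀ : 0 ≤ C)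
    (hC : ∀ ψ : 𝓓((⊤ : TopologicalSpace.Opens E), ℂ),
      ‖∫ x, f x * ψ x‖ ≤ C * lpNorm ψ 2 volume) :
    lpNorm f 2 volume ≤ C := by
  set F := hf.star.toLp (star f) with hF
  have hnorm : ‖F‖ = lpNorm f 2 volume := by
    rw [hF, Lp.norm_toLp, eLpNorm_star, toReal_eLpNorm hf.1]
  have hinner : ∀ g : Lp ℂ 2 (volume : Measure E), ‖inner ℂ F g‖ ≤ C * ‖g‖ := by
    have hclosed : IsClosed {g : Lp ℂ 2 (volume : Measure E) | ‖inner ℂ F g‖ ≤ C * ‖g‖} :=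
      isClosed_le (by fun_prop) (by fun_prop)
    intro g
    refine hclosed.closure_subset_iff.2 ?_
      (Lp.dense_hasCompactSupport_contDiff (p := 2) (by norm_num) g)
    rintro g ⟨ψ, hgψ, hψc, hψ⟩
    have hg : ‖g‖ = lpNorm ψ 2 volume := by
      rw [Lp.norm_def, eLpNorm_congr_ae hgψ, toReal_eLpNorm hψ.continuous.aestronglyMeasurable]
    have hpair : inner ℂ F g = ∫ x, f x * ψ x := by
      rw [L2.inner_def]
      refine integral_congr_ae ?_
      filter_upwards [hf.star.coeFn_toLp, hgψ] with x hx hgx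
      rw [hx, hgx, RCLike.inner_apply, Pi.star_apply, RCLike.star_def, RCLike.conj_conj, mul_comm]
    exact (hpair ▸ hg ▸ hC ⟨ψ, hψ, hψc, Set.subset_univ _⟩ :)
  rw [← hnorm, ← innerSL_apply_norm (𝕜 := ℂ)]
  exact ContinuousLinearMap.opNorm_le_bound _ hC₀ hinner

end Duality

section WeakGradient

open TopologicalSpace (Opens)

theorem hasDerivAt_integral_comp_add_smul_mul {E : Type*} [NormedAddCommGroup E] [NormedSpace ℝ E]
    [FiniteDimensional ℝ E] [MeasurableSpace E] [BorelSpace E] {μ : Measure E}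
    [μ.IsAddHaarMeasure] {u : E → ℂ}
    (hu : LocallyIntegrable u μ) {ψ : E → ℂ} (hψ : ContDiff ℝ 1 ψ) (hψc : HasCompactSupport ψ)
    (h : E) (t : ℝ) :
    HasDerivAt (fun t : ℝ => ∫ x, u (x + t • h) * ψ x ∂μ)
      (-∫ x, u (x + t • h) * fderiv ℝ ψ x h ∂μ) t := by
  have hconv : ∀ (f : E → ℂ) (z : E),
      convolution u (fun y => f (-y)) (ContinuousLinearMap.mul ℝ ℂ) μ z =
        ∫ x, u (x + z) * f x ∂μ := by
    intro f z
    rw [convolution_def, ← integral_add_right_eq_self _ z]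
    simp
  have hψc' : HasCompactSupport fun y => ψ (-y) := hψc.comp_homeomorph (Homeomorph.neg E)
  have hψ' : ContDiff ℝ 1 fun y => ψ (-y) := hψ.comp contDiff_neg
  have hfderiv : ∀ y, fderiv ℝ (fun y => ψ (-y)) y h = -fderiv ℝ ψ (-y) h := by
    intro y
    have hcomp := (hψ.differentiable one_ne_zero (-y)).hasFDerivAt.comp y (hasFDerivAt_id y).fun_neg
    simpa [Function.comp_def] using DFunLike.congr_fun hcomp.fderiv h
  have hderiv := (hψc'.hasFDerivAt_convolution_right (ContinuousLinearMap.mul ℝ ℂ) hu hψ'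
    (t • h)).comp_hasDerivAt t ((hasDerivAt_id t).smul_const h)
  rw [one_smul, convolution_precompR_apply _ hu (hψc'.fderiv ℝ) (hψ'.continuous_fderiv one_ne_zero)]
    at hderiv
  simp only [hfderiv, hconv fun x => -fderiv ℝ ψ x h] at hderiv
  simpa only [Function.comp_def, hconv, id_eq, mul_neg, integral_neg] using hderiv

variable {n : ℕ} {u : Rn n → ℂ} {G : Rn n → Cn n}

/-- The bilinear product `h · v = ∑ᵢ hᵢ vᵢ` with a real vector `h`, as a linear form in `v ∈ ℂⁿ`. -/
def realDot (h : Rn n) : Cn n →L[ℂ] ℂ := innerSL ℂ (WithLp.toLp 2 fun i => (h i : ℂ))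

theorem realDot_apply (h : Rn n) (v : Cn n) : realDot h v = ∑ i, (h i : ℂ) * v i := by
  simp [realDot, PiLp.inner_apply, mul_comm]

theorem norm_realDot (h : Rn n) : ‖realDot h‖ = ‖h‖ := by
  simp [realDot, innerSL_apply_norm, EuclideanSpace.norm_eq]

theorem fderiv_eq_realDot (φ : Rn n → ℂ) (x h : Rn n) :
    fderiv ℝ φ x h = realDot h (WithLp.toLp 2 fun i => partialDeriv i φ x) := by
  rw [realDot_apply]
  conv_lhs => rw [← (EuclideanSpace.basisFun (Fin n) ℝ).sum_repr h, map_sum]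
  simp [partialDeriv]

/-- `u` and its weak gradient `G` are square integrable, that is, `u ∈ H¹(ℝⁿ)` and `G = ∇u`. -/
structure HasL2Gradient (u : Rn n → ℂ) (G : Rn n → Cn n) : Prop where
  memLp : MemLp u 2
  memLp_grad : MemLp G 2
  integral_mul_partialDeriv : ∀ (φ : 𝓓((⊤ : Opens (Rn n)), ℂ)) (i : Fin n),
    ∫ x, u x * partialDeriv i φ x = -∫ x, G x i * φ x

theorem HasL2Gradient.isWeakGradient (hu : HasL2Gradient u G) : IsWeakGradient u G :=
  ⟨hu.memLp.locallyIntegrable (by norm_num), hu.memLp_grad.locallyIntegrable (by norm_num),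
    hu.integral_mul_partialDeriv⟩

theorem memLp_testFunction (φ : 𝓓((⊤ : Opens (Rn n)), ℂ)) : MemLp φ 2 :=
  φ.continuous.memLp_of_hasCompactSupport φ.hasCompactSupport

theorem memLp_partialDeriv (i : Fin n) (φ : 𝓓((⊤ : Opens (Rn n)), ℂ)) :
    MemLp (partialDeriv i φ) 2 :=
  Continuous.memLp_of_hasCompactSupport
    ((φ.contDiff.continuous_fderiv (by simp)).clm_apply continuous_const)
    (φ.hasCompactSupport.fderiv_apply ℝ _)

theorem hasL2Gradient_testFunction (φ : 𝓓((⊤ : Opens (Rn n)), ℂ)) :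
    HasL2Gradient φ fun x => WithLp.toLp 2 fun i => partialDeriv i φ x := by
  refine ⟨memLp_testFunction φ, memLp_piLp_iff.2 fun i => memLp_partialDeriv i φ, fun ψ i => ?_⟩
  exact integral_mul_fderiv_eq_neg_fderiv_mul_of_integrable
    ((memLp_partialDeriv i φ).integrable_mul (memLp_testFunction ψ))
    ((memLp_testFunction φ).integrable_mul (memLp_partialDeriv i ψ))
    ((memLp_testFunction φ).integrable_mul (memLp_testFunction ψ))
    (fun x _ => φ.contDiff.differentiable (by simp) x)
    fun x _ => ψ.contDiff.differentiable (by simp) x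

theorem MemW.exists_hasL2Gradient (hu : MemW 1 2 u) : ∃ G, HasL2Gradient u G := by
  obtain ⟨hu, hB⟩ := hu
  have hderiv : ∀ i : Fin n, ∃ Gi : Lp ℂ 2 (volume : Measure (Rn n)), (Gi : 𝓢'(Rn n, ℂ)) =
      LineDeriv.lineDerivOp (EuclideanSpace.single i (1 : ℝ)) (hu.toLp u : 𝓢'(Rn n, ℂ)) := by
    intro i
    obtain ⟨Gi, hGi⟩ := memSobolev_zero_iff.1
      ((hB.lineDerivOp (m := EuclideanSpace.single i (1 : ℝ))).mono (s' := 0) (by norm_num))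
    exact ⟨Gi, hGi.symm⟩
  choose Gi hGi using hderiv
  refine ⟨fun x => WithLp.toLp 2 fun i => Gi i x, hu, memLp_piLp_iff.2 fun i => Lp.memLp (Gi i),
    fun φ i => ?_⟩
  let ψ : 𝓢(Rn n, ℂ) := φ.hasCompactSupport.toSchwartzMap φ.contDiff
  have htest := congrArg (fun T : 𝓢'(Rn n, ℂ) => T ψ) (hGi i)
  simp only [TemperedDistribution.lineDerivOp_apply_apply, Lp.toTemperedDistribution_apply,
    smul_eq_mul] at htest
  have hψ : ∀ x, (-LineDeriv.lineDerivOp (EuclideanSpace.single i (1 : ℝ)) ψ : 𝓢(Rn n, ℂ)) x =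
      -partialDeriv i φ x := by
    intro x
    rw [neg_apply, SchwartzMap.lineDerivOp_apply_eq_fderiv]
    rfl
  have hint : ∫ x, -(u x * partialDeriv i φ x) = ∫ x, Gi i x * φ x := by
    refine Eq.trans (integral_congr_ae ?_) (htest.symm.trans
      (integral_congr_ae (ae_of_all _ fun x => mul_comm _ _)))
    filter_upwards [hu.coeFn_toLp] with x hx
    rw [hx, hψ, neg_mul, mul_comm]
  rw [integral_neg] at hint
  exact neg_eq_iff_eq_neg.1 hint

theorem HasL2Gradient.comp_add_right (hu : HasL2Gradient u G) (h : Rn n) :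
    HasL2Gradient (fun x => u (x + h)) fun x => G (x + h) := by
  refine ⟨memLp_comp_add_right hu.memLp h, memLp_comp_add_right hu.memLp_grad h, fun φ i => ?_⟩
  let ψ : 𝓓((⊤ : Opens (Rn n)), ℂ) := ⟨fun y => φ (y - h),
    φ.contDiff.comp (contDiff_id.sub contDiff_const),
    φ.hasCompactSupport.comp_homeomorph (Homeomorph.subRight h), Set.subset_univ _⟩
  have hψ : ∀ y, partialDeriv i ψ y = partialDeriv i φ (y - h) := fun y => by
    rw [partialDeriv, partialDeriv, ← fderiv_comp_sub]
    rfl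
  have hψφ : ∀ y, ψ y = φ (y - h) := fun _ => rfl
  have htest := hu.integral_mul_partialDeriv ψ i
  rw [← integral_add_right_eq_self _ h, ← integral_add_right_eq_self (fun x => G x i * ψ x) h]
    at htest
  simpa only [hψ, hψφ, add_sub_cancel_right] using htest

theorem HasL2Gradient.integral_mul_fderiv (hu : HasL2Gradient u G) (φ : 𝓓((⊤ : Opens (Rn n)), ℂ))
    (h : Rn n) : ∫ x, u x * fderiv ℝ φ x h = -∫ x, realDot h (G x) * φ x := by
  have hint_u (i) : Integrable fun x => (h i : ℂ) * (u x * partialDeriv i φ x) :=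
    (hu.memLp.integrable_mul (memLp_partialDeriv i φ)).const_mul _
  have hint_G (i) : Integrable fun x => (h i : ℂ) * (G x i * φ x) :=
    ((memLp_piLp_iff.1 hu.memLp_grad i).integrable_mul (memLp_testFunction φ)).const_mul _
  simp only [fderiv_eq_realDot, realDot_apply, Finset.mul_sum, Finset.sum_mul, mul_left_comm (u _),
    mul_assoc, integral_finsetSum _ fun i _ => hint_u i, integral_finsetSum _ fun i _ => hint_G i,
    integral_const_mul, hu.integral_mul_partialDeriv φ, mul_neg, Finset.sum_neg_distrib]

theorem HasL2Gradient.hasDerivAt_integral (hu : HasL2Gradient u G)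
    (ψ : 𝓓((⊤ : Opens (Rn n)), ℂ)) (h : Rn n) (t : ℝ) :
    HasDerivAt (fun t : ℝ => ∫ x, u (x + t • h) * ψ x)
      (∫ x, realDot h (G (x + t • h)) * ψ x) t := by
  have := hasDerivAt_integral_comp_add_smul_mul hu.isWeakGradient.1 (ψ.contDiff.of_le (by simp))
    ψ.hasCompactSupport h t
  rwa [(hu.comp_add_right (t • h)).integral_mul_fderiv ψ h, neg_neg] at this

end WeakGradient

section Pairing

variable {α : Type*} [MeasurableSpace α] {μ : Measure α} {f f' g g' : α → ℂ}

theorem norm_integral_mul_le_lpNorm_mul_lpNorm (hf : MemLp f 2 μ) (hg : MemLp g 2 μ) :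
    ‖∫ x, f x * g x ∂μ‖ ≤ lpNorm f 2 μ * lpNorm g 2 μ := by
  have hfg : AEStronglyMeasurable (fun x => f x * g x) μ := hf.1.mul hg.1
  refine (norm_integral_le_integral_norm _).trans ?_
  rw [← lpNorm_one_eq_integral_norm hfg, ← toReal_eLpNorm hfg, ← toReal_eLpNorm hf.1,
    ← toReal_eLpNorm hg.1, ← ENNReal.toReal_mul]
  exact ENNReal.toReal_mono (ENNReal.mul_ne_top hf.2.ne hg.2.ne)
    (eLpNorm_smul_le_mul_eLpNorm hg.1 hf.1 : eLpNorm (f • g) 1 μ ≤ _)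

theorem norm_integral_mul_sub_integral_mul_le (hf : MemLp f 2 μ) (hf' : MemLp f' 2 μ)
    (hg : MemLp g 2 μ) (hg' : MemLp g' 2 μ) :
    ‖(∫ x, f x * g x ∂μ) - ∫ x, f' x * g' x ∂μ‖ ≤
      lpNorm (f - f') 2 μ * lpNorm g 2 μ + lpNorm f' 2 μ * lpNorm (g - g') 2 μ := by
  have hsplit : (∫ x, f x * g x ∂μ) - ∫ x, f' x * g' x ∂μ =
      (∫ x, (f - f') x * g x ∂μ) + ∫ x, f' x * (g - g') x ∂μ :=
    calc _ = ∫ x, f x * g x - f' x * g' x ∂μ :=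
          (integral_sub (hf.integrable_mul hg) (hf'.integrable_mul hg')).symm
      _ = ∫ x, (f - f') x * g x + f' x * (g - g') x ∂μ := by
          congr with x
          simp only [Pi.sub_apply]
          ring
      _ = _ := integral_add ((hf.sub hf').integrable_mul hg) (hf'.integrable_mul (hg.sub hg'))
  rw [hsplit]
  exact norm_add_le_of_le (norm_integral_mul_le_lpNorm_mul_lpNorm (hf.sub hf') hg)
    (norm_integral_mul_le_lpNorm_mul_lpNorm hf' (hg.sub hg'))

end Pairing

section Increment

variable {n : ℕ} {u : Rn n → ℂ} {F G : Rn n → Cn n}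

theorem memLp_realDot (hG : MemLp G 2) (h : Rn n) : MemLp (fun x => realDot h (G x)) 2 :=
  (realDot h).comp_memLp' hG

theorem lpNorm_realDot_le (hG : MemLp G 2) (h : Rn n) :
    lpNorm (fun x => realDot h (G x)) 2 volume ≤ ‖h‖ * lpNorm G 2 volume := by
  rw [← norm_realDot, ← toReal_eLpNorm (memLp_realDot hG h).1, ← toReal_eLpNorm hG.1,
    ← toReal_enorm, ← ENNReal.toReal_mul]
  exact ENNReal.toReal_mono (ENNReal.mul_ne_top enorm_ne_top hG.2.ne)
    (eLpNorm_le_nnreal_smul_eLpNorm_of_ae_le_mul (ae_of_all _ fun x => (realDot h).le_opNNNorm _) 2)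

theorem HasL2Gradient.lpNorm_fwdDiff_sub_realDot_le_of_forall (hu : HasL2Gradient u G)
    (hF : MemLp F 2) {h : Rn n} {C : ℝ}
    (hC : ∀ t ∈ Set.Icc (0 : ℝ) 1, lpNorm (fun x => G (x + t • h) - F x) 2 volume ≤ C) :
    lpNorm (fun x => Δ_[h] u x - realDot h (F x)) 2 volume ≤ ‖h‖ * C := by
  have hC₀ : 0 ≤ C := lpNorm_nonneg.trans (hC 0 (by simp))
  refine lpNorm_two_le_of_norm_integral_mul_le ((memLp_fwdDiff hu.memLp h).sub (memLp_realDot hF h))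
    (by positivity) fun ψ => ?_
  have hψ := memLp_testFunction ψ
  have hsub {f g : Rn n → ℂ} (hf : MemLp f 2) (hg : MemLp g 2) :
      ∫ x, (f x - g x) * ψ x = (∫ x, f x * ψ x) - ∫ x, g x * ψ x := by
    simpa only [sub_mul] using! integral_sub (hf.integrable_mul hψ) (hg.integrable_mul hψ)
  have hderiv (t : ℝ) :
      HasDerivAt (fun t : ℝ => (∫ x, u (x + t • h) * ψ x) - t * ∫ x, realDot h (F x) * ψ x)
        (∫ x, realDot h (G (x + t • h) - F x) * ψ x) t := by
    refine ((hu.hasDerivAt_integral ψ h t).fun_sub ((hasDerivAt_id (t : ℂ)).comp_ofReal.mul_const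
      (∫ x, realDot h (F x) * ψ x))).congr_deriv ?_
    simp only [map_sub, one_mul]
    exact (hsub (memLp_realDot (memLp_comp_add_right hu.memLp_grad _) h) (memLp_realDot hF h)).symm
  have hbound (t : ℝ) (ht : t ∈ Set.Ico (0 : ℝ) 1) :
      ‖∫ x, realDot h (G (x + t • h) - F x) * ψ x‖ ≤ ‖h‖ * C * lpNorm ψ 2 volume := by
    have hGF := (memLp_comp_add_right hu.memLp_grad (t • h)).sub hF
    refine (norm_integral_mul_le_lpNorm_mul_lpNorm (memLp_realDot hGF h) hψ).trans ?_
    refine mul_le_mul_of_nonneg_right ((lpNorm_realDot_le hGF h).trans ?_) lpNorm_nonneg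
    exact mul_le_mul_of_nonneg_left (hC t (Set.Ico_subset_Icc_self ht)) (norm_nonneg h)
  have hmvt := norm_image_sub_le_of_norm_deriv_le_segment_01'
    (fun t _ => (hderiv t).hasDerivWithinAt) hbound
  have hval : ∫ x, (Δ_[h] u x - realDot h (F x)) * ψ x =
      (∫ x, u (x + h) * ψ x) - (∫ x, u x * ψ x) - ∫ x, realDot h (F x) * ψ x := by
    rw [hsub (memLp_fwdDiff hu.memLp h) (memLp_realDot hF h)]
    exact congrArg (· - _) (hsub (memLp_comp_add_right hu.memLp h) hu.memLp)
  refine (congrArg norm hval).trans_le ?_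
  simpa [sub_right_comm] using hmvt

theorem HasL2Gradient.lpNorm_fwdDiff_le (hu : HasL2Gradient u G) (h : Rn n) :
    lpNorm (Δ_[h] u) 2 volume ≤ ‖h‖ * lpNorm G 2 volume := by
  simpa using hu.lpNorm_fwdDiff_sub_realDot_le_of_forall (F := 0) (h := h) MemLp.zero fun t _ => by
    simpa using (lpNorm_comp_add_right hu.memLp_grad (t • h)).le

theorem HasL2Gradient.isLittleO_lpNorm_fwdDiff_sub_realDot (hu : HasL2Gradient u G) :
    (fun h => lpNorm (fun x => Δ_[h] u x - realDot h (G x)) 2 volume) =o[𝓝 0]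
      fun h : Rn n => ‖h‖ := by
  refine Asymptotics.isLittleO_iff.2 fun ε hε => ?_
  obtain ⟨δ, hδ, hball⟩ := Metric.eventually_nhds_iff_ball.1
    ((tendsto_lpNorm_fwdDiff hu.memLp_grad one_le_two ENNReal.ofNat_ne_top).eventually_le_const hε)
  filter_upwards [Metric.ball_mem_nhds 0 hδ] with h hh
  rw [Real.norm_of_nonneg lpNorm_nonneg, norm_norm, mul_comm]
  refine hu.lpNorm_fwdDiff_sub_realDot_le_of_forall hu.memLp_grad fun t ht => hball (t • h) ?_
  rw [mem_ball_zero_iff] at hh ⊢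
  rw [norm_smul, Real.norm_of_nonneg ht.1]
  exact (mul_le_of_le_one_left (norm_nonneg h) ht.2).trans_lt hh

end Increment

section Radial

open Set Module

theorem pow_sub_one_smul_rpow {d : ℕ} (hd : d ≠ 0) (a : ℝ) {r : ℝ} (hr : 0 < r) :
    r ^ (d - 1) • r ^ a = r ^ (d + a - 1) := by
  rw [smul_eq_mul, ← Real.rpow_natCast, ← Real.rpow_add hr,
    Nat.cast_sub (Nat.one_le_iff_ne_zero.2 hd), Nat.cast_one, sub_add_eq_add_sub]

theorem compl_ball_zero_eq_norm_preimage {E : Type*} [SeminormedAddGroup E] (δ : ℝ) :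
    (Metric.ball (0 : E) δ)ᶜ = norm ⁻¹' Ici δ := by
  rw [ball_zero_eq, ← compl_Iio]
  rfl

variable {E F : Type*} [NormedAddCommGroup E] [NormedSpace ℝ E] [FiniteDimensional ℝ E]
  [Nontrivial E] [MeasurableSpace E] [BorelSpace E] [NormedAddCommGroup F] [NormedSpace ℝ F]
  (μ : Measure E) [μ.IsAddHaarMeasure] {S : Set ℝ} {a δ : ℝ}

theorem setIntegral_norm_preimage (hS : MeasurableSet S) (f : ℝ → F) :
    ∫ x in norm ⁻¹' S, f ‖x‖ ∂μ = finrank ℝ E • μ.real (Metric.ball 0 1) •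
      ∫ r in Ioi 0 ∩ S, r ^ (finrank ℝ E - 1) • f r := by
  rw [← setIntegral_indicator hS, ← integral_indicator (measurable_norm hS)]
  simp only [indicator_smul, ← integral_fun_norm_addHaar]
  rfl

theorem integrableOn_norm_preimage (hS : MeasurableSet S) (f : ℝ → F) :
    IntegrableOn (fun x => f ‖x‖) (norm ⁻¹' S) μ ↔
      IntegrableOn (fun r => r ^ (finrank ℝ E - 1) • f r) (Ioi 0 ∩ S) := by
  rw [inter_comm, ← integrableOn_indicator_iff hS, ← integrable_indicator_iff (measurable_norm hS)]
  simp only [indicator_smul, ← integrable_fun_norm_addHaar μ]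
  rfl

theorem integrableOn_ball_norm_rpow (ha : -finrank ℝ E < a) (δ : ℝ) :
    IntegrableOn (fun x : E => ‖x‖ ^ a) (Metric.ball 0 δ) μ := by
  rw [integrableOn_fun_norm_addHaar μ (f := (· ^ a)), integrableOn_congr_fun
    (fun r hr => pow_sub_one_smul_rpow finrank_pos.ne' a hr.1) measurableSet_Ioo]
  rcases le_total δ 0 with hδ | hδ
  · simp [Ioo_eq_empty_of_le hδ]
  · rw [← intervalIntegrable_iff_integrableOn_Ioo_of_le hδ]
    exact intervalIntegral.intervalIntegrable_rpow' (by linarith)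

theorem setIntegral_ball_norm_rpow (ha : -finrank ℝ E < a) (hδ : 0 ≤ δ) :
    ∫ x in Metric.ball (0 : E) δ, ‖x‖ ^ a ∂μ =
      finrank ℝ E * μ.real (Metric.ball 0 1) * (δ ^ (finrank ℝ E + a) / (finrank ℝ E + a)) := by
  have hball := setIntegral_norm_preimage μ (measurableSet_Iio (a := δ)) (· ^ a)
  rw [Ioi_inter_Iio, setIntegral_congr_fun measurableSet_Ioo
    fun r hr => pow_sub_one_smul_rpow finrank_pos.ne' a hr.1, ← integral_Ioc_eq_integral_Ioo,
    ← intervalIntegral.integral_of_le hδ, integral_rpow (Or.inl (by linarith)),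
    Real.zero_rpow (by linarith), sub_add_cancel, sub_zero, nsmul_eq_mul, smul_eq_mul,
    ← mul_assoc] at hball
  rwa [ball_zero_eq]

theorem integrableOn_compl_ball_norm_rpow (ha : a < -finrank ℝ E) (hδ : 0 < δ) :
    IntegrableOn (fun x : E => ‖x‖ ^ a) (Metric.ball 0 δ)ᶜ μ := by
  rw [compl_ball_zero_eq_norm_preimage, integrableOn_norm_preimage μ measurableSet_Ici (· ^ a),
    inter_eq_right.2 (Ici_subset_Ioi.2 hδ), integrableOn_congr_fun
    (fun r (hr : r ∈ Ici δ) => pow_sub_one_smul_rpow finrank_pos.ne' a (hδ.trans_le hr))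
    measurableSet_Ici, integrableOn_Ici_iff_integrableOn_Ioi]
  exact integrableOn_Ioi_rpow_of_lt (by linarith) hδ

theorem setIntegral_compl_ball_norm_rpow (ha : a < -finrank ℝ E) (hδ : 0 < δ) :
    ∫ x in (Metric.ball (0 : E) δ)ᶜ, ‖x‖ ^ a ∂μ =
      finrank ℝ E * μ.real (Metric.ball 0 1) * (-δ ^ (finrank ℝ E + a) / (finrank ℝ E + a)) := by
  rw [compl_ball_zero_eq_norm_preimage, setIntegral_norm_preimage μ measurableSet_Ici (· ^ a),
    inter_eq_right.2 (Ici_subset_Ioi.2 hδ), setIntegral_congr_fun measurableSet_Ici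
    fun r (hr : r ∈ Ici δ) => pow_sub_one_smul_rpow finrank_pos.ne' a (hδ.trans_le hr),
    integral_Ici_eq_integral_Ioi, integral_Ioi_rpow_of_lt (by linarith) hδ, sub_add_cancel,
    nsmul_eq_mul, smul_eq_mul, ← mul_assoc]

end Radial

section Isotropy

variable {n : ℕ} {μ : Measure (Rn n)} {k : ℝ → ℝ}

/-- The quadratic form `∑ᵢⱼ Aᵢⱼ hᵢ hⱼ` of a complex matrix `A`, at a real vector `h`. -/
def quadForm (A : Matrix (Fin n) (Fin n) ℂ) (h : Rn n) : ℂ :=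
  ∑ i, ∑ j, ((h i * h j : ℝ) : ℂ) * A i j

theorem integral_radial_mul_comp_linearIsometryEquiv {e : Rn n ≃ₗᵢ[ℝ] Rn n}
    (he : MeasurePreserving e μ μ) (k : ℝ → ℝ) (f : Rn n → ℝ) :
    ∫ h, k ‖h‖ * f (e h) ∂μ = ∫ h, k ‖h‖ * f h ∂μ := by
  simpa only [e.norm_map] using
    he.integral_comp e.toHomeomorph.measurableEmbedding fun h => k ‖h‖ * f h

theorem integral_radial_mul_coord_mul_coord_eq_zero
    (hμ : ∀ e : Rn n ≃ₗᵢ[ℝ] Rn n, MeasurePreserving e μ μ) (k : ℝ → ℝ) {i j : Fin n}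
    (hij : i ≠ j) : ∫ h, k ‖h‖ * (h i * h j) ∂μ = 0 := by
  let e : Rn n ≃ₗᵢ[ℝ] Rn n := LinearIsometryEquiv.piLpCongrRight 2
    fun l => if l = i then LinearIsometryEquiv.neg ℝ else LinearIsometryEquiv.refl ℝ ℝ
  have he (h : Rn n) : e h i * e h j = -(h i * h j) := by simp [e, hij.symm]
  have hreflect := integral_radial_mul_comp_linearIsometryEquiv (hμ e) k fun h => h i * h j
  simp only [he, mul_neg, integral_neg] at hreflect
  exact self_eq_neg.1 hreflect.symm

theorem integral_radial_mul_coord_sq_eq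
    (hμ : ∀ e : Rn n ≃ₗᵢ[ℝ] Rn n, MeasurePreserving e μ μ) (k : ℝ → ℝ) (i j : Fin n) :
    ∫ h, k ‖h‖ * h i ^ 2 ∂μ = ∫ h, k ‖h‖ * h j ^ 2 ∂μ := by
  let e : Rn n ≃ₗᵢ[ℝ] Rn n := LinearIsometryEquiv.piLpCongrLeft 2 ℝ ℝ (Equiv.swap i j)
  have he (h : Rn n) : e h j = h i := by
    simp [e, LinearIsometryEquiv.piLpCongrLeft_apply, Equiv.piCongrLeft']
  simpa only [he] using integral_radial_mul_comp_linearIsometryEquiv (hμ e) k fun h => h j ^ 2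

theorem norm_coord_mul_coord_le (h : Rn n) (i j : Fin n) : ‖h i * h j‖ ≤ ‖h‖ ^ 2 := by
  rw [norm_mul, sq]
  gcongr <;> exact PiLp.norm_apply_le h _

theorem integrable_radial_mul_coord_mul_coord (hk : Integrable (fun h => k ‖h‖ * ‖h‖ ^ 2) μ)
    (i j : Fin n) : Integrable (fun h => k ‖h‖ * (h i * h j)) μ := by
  have hbdd (h : Rn n) : ‖h i * h j / ‖h‖ ^ 2‖ ≤ 1 := by
    rw [norm_div, norm_pow, norm_norm]
    exact div_le_one_of_le₀ (norm_coord_mul_coord_le h i j) (by positivity)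
  refine (hk.mul_bdd (c := 1) (g := fun h : Rn n => h i * h j / ‖h‖ ^ 2)
    (Measurable.aestronglyMeasurable (by fun_prop)) (ae_of_all _ hbdd)).congr
    (ae_of_all _ fun h => ?_)
  rcases eq_or_ne h 0 with rfl | hh
  · simp
  · have := norm_ne_zero_iff.2 hh
    field_simp

theorem integral_radial_mul_coord_sq (hμ : ∀ e : Rn n ≃ₗᵢ[ℝ] Rn n, MeasurePreserving e μ μ)
    (hk : Integrable (fun h => k ‖h‖ * ‖h‖ ^ 2) μ) (i : Fin n) :
    ∫ h, k ‖h‖ * h i ^ 2 ∂μ = (∫ h, k ‖h‖ * ‖h‖ ^ 2 ∂μ) / n := by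
  have : NeZero n := i.neZero
  have hint (j : Fin n) : Integrable (fun h => k ‖h‖ * h j ^ 2) μ := by
    simpa only [sq] using integrable_radial_mul_coord_mul_coord hk j j
  simp only [EuclideanSpace.real_norm_sq_eq, Finset.mul_sum]
  rw [integral_finsetSum _ fun j _ => hint j,
    Finset.sum_congr rfl fun j _ => integral_radial_mul_coord_sq_eq hμ k j i, Finset.sum_const,
    Finset.card_univ, Fintype.card_fin, nsmul_eq_mul, mul_div_cancel_left₀ _ (NeZero.ne (n : ℝ))]

theorem radial_mul_quadForm (A : Matrix (Fin n) (Fin n) ℂ) (h : Rn n) :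
    (k ‖h‖ : ℂ) * quadForm A h = ∑ i, ∑ j, ((k ‖h‖ * (h i * h j) : ℝ) : ℂ) * A i j := by
  simp only [quadForm, Finset.mul_sum, Complex.ofReal_mul, mul_assoc]

theorem integrable_radial_mul_quadForm (hk : Integrable (fun h => k ‖h‖ * ‖h‖ ^ 2) μ)
    (A : Matrix (Fin n) (Fin n) ℂ) : Integrable (fun h => (k ‖h‖ : ℂ) * quadForm A h) μ := by
  simp only [radial_mul_quadForm]
  exact integrable_finsetSum _ fun i _ => integrable_finsetSum _ fun j _ =>
    (integrable_radial_mul_coord_mul_coord hk i j).ofReal.mul_const _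

theorem integral_radial_mul_quadForm (hμ : ∀ e : Rn n ≃ₗᵢ[ℝ] Rn n, MeasurePreserving e μ μ)
    (hk : Integrable (fun h => k ‖h‖ * ‖h‖ ^ 2) μ) (A : Matrix (Fin n) (Fin n) ℂ) :
    ∫ h, (k ‖h‖ : ℂ) * quadForm A h ∂μ =
      (((∫ h, k ‖h‖ * ‖h‖ ^ 2 ∂μ) / n : ℝ) : ℂ) * A.trace := by
  have hint (i j : Fin n) : Integrable (fun h => ((k ‖h‖ * (h i * h j) : ℝ) : ℂ) * A i j) μ :=
    (integrable_radial_mul_coord_mul_coord hk i j).ofReal.mul_const _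
  simp only [radial_mul_quadForm, Matrix.trace, Matrix.diag_apply, Finset.mul_sum]
  rw [integral_finsetSum _ fun i _ => integrable_finsetSum _ fun j _ => hint i j]
  refine Finset.sum_congr rfl fun i _ => ?_
  rw [integral_finsetSum _ fun j _ => hint i j, Finset.sum_eq_single i]
  · rw [integral_mul_const, integral_complex_ofReal, ← integral_radial_mul_coord_sq hμ hk i]
    simp only [sq]
  · intro j _ hji
    rw [integral_mul_const, integral_complex_ofReal,
      integral_radial_mul_coord_mul_coord_eq_zero hμ k hji.symm, Complex.ofReal_zero, zero_mul]
  · exact fun hi => absurd (Finset.mem_univ i) hi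

theorem measurePreserving_restrict_ball (e : Rn n ≃ₗᵢ[ℝ] Rn n) (δ : ℝ) :
    MeasurePreserving e (volume.restrict (Metric.ball 0 δ))
      (volume.restrict (Metric.ball 0 δ)) := by
  simpa using e.measurePreserving.restrict_preimage
    (Metric.isOpen_ball (x := (0 : Rn n)) (ε := δ)).measurableSet

end Isotropy

section Kernel

open Real Set

variable {n : ℕ} {s δ : ℝ}

/-- The factor `w` in `C_{n,s} = (1 - s) w(s)`; it stays bounded and positive as `s → 1`. -/
def fracConstFactor (n : ℕ) (s : ℝ) : ℝ :=
  4 ^ s * Gamma ((n : ℝ) / 2 + s) * s / (π ^ ((n : ℝ) / 2) * Gamma (2 - s))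

theorem fracConst_eq (hs : s ∈ Ioo (0 : ℝ) 1) : fracConst n s = (1 - s) * fracConstFactor n s := by
  have hs₀ : 0 < s := hs.1
  have hs₁ : 0 < 1 - s := sub_pos.2 hs.2
  have hGamma : Gamma (2 - s) = (1 - s) * (-s * Gamma (-s)) := by
    rw [← Real.Gamma_add_one (neg_ne_zero.2 hs₀.ne'), neg_add_eq_sub,
      ← Real.Gamma_add_one hs₁.ne', sub_add_eq_add_sub, one_add_one_eq_two]
  have habs : |Gamma (2 - s)| = (1 - s) * (s * |Gamma (-s)|) := by
    rw [hGamma, abs_mul, abs_mul, abs_neg, abs_of_pos hs₀, abs_of_pos hs₁]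
  rw [abs_of_pos (Gamma_pos_of_pos (by linarith))] at habs
  rw [fracConst, fracConstFactor, habs]
  field_simp

theorem fracConst_nonneg (hs : 0 < s) : 0 ≤ fracConst n s := by
  have : 0 < Gamma ((n : ℝ) / 2 + s) := Gamma_pos_of_pos (by positivity)
  rw [fracConst]
  positivity

theorem continuousAt_Gamma_of_pos {t : ℝ} (ht : 0 < t) : ContinuousAt Gamma t :=
  (differentiableAt_Gamma fun m => ((neg_nonpos.2 m.cast_nonneg).trans_lt ht).ne').continuousAt

theorem tendsto_fracConstFactor :
    Tendsto (fracConstFactor n) (𝓝[<] 1) (𝓝 (4 * Gamma ((n : ℝ) / 2 + 1) / π ^ ((n : ℝ) / 2))) := by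
  have hcont : ContinuousAt (fracConstFactor n) 1 := by
    have hnum : ContinuousAt (fun s : ℝ => Gamma ((n : ℝ) / 2 + s)) 1 :=
      (continuousAt_Gamma_of_pos (by positivity)).comp (f := fun s : ℝ => (n : ℝ) / 2 + s)
        (by fun_prop)
    have hden : ContinuousAt (fun s : ℝ => Gamma (2 - s)) 1 :=
      (continuousAt_Gamma_of_pos (by norm_num)).comp (f := fun s : ℝ => 2 - s) (by fun_prop)
    have hpow : ContinuousAt (fun s : ℝ => (4 : ℝ) ^ s) 1 :=
      (Real.continuous_const_rpow (by norm_num)).continuousAt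
    refine ((hpow.mul hnum).mul continuousAt_id).div (continuousAt_const.mul hden) ?_
    norm_num
    positivity
  convert hcont.tendsto.mono_left nhdsWithin_le_nhds using 2
  norm_num [fracConstFactor]

theorem measureReal_ball_one [NeZero n] :
    (volume : Measure (Rn n)).real (Metric.ball 0 1) = π ^ ((n : ℝ) / 2) / Gamma (n / 2 + 1) := by
  rw [Measure.real, EuclideanSpace.volume_ball, ENNReal.ofReal_one, one_pow, one_mul,
    Fintype.card_fin, ENNReal.toReal_ofReal (by positivity), Real.sqrt_eq_rpow,
    ← Real.rpow_mul_natCast pi_nonneg, one_div_mul_eq_div]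

/-- The kernel `C_{n,s} / 2 · r^{-n-2s}`, `r = |x - y|`, of the quadratic form of `(-Δ)ˢ`. -/
def fracKernel (n : ℕ) (s r : ℝ) : ℝ := fracConst n s / 2 * r ^ (-(n : ℝ) - 2 * s)

theorem fracKernel_nonneg {r : ℝ} (hs : 0 < s) (hr : 0 ≤ r) : 0 ≤ fracKernel n s r := by
  have := fracConst_nonneg (n := n) hs
  rw [fracKernel]
  positivity

theorem measurable_fracKernel (n : ℕ) (s : ℝ) : Measurable (fracKernel n s) := by
  unfold fracKernel
  fun_prop

theorem ae_fracKernel_mul_sq_eq [NeZero n] (s : ℝ) : ∀ᵐ h : Rn n,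
    fracKernel n s ‖h‖ * ‖h‖ ^ 2 = fracConst n s / 2 * ‖h‖ ^ (2 - (n : ℝ) - 2 * s) := by
  filter_upwards [compl_mem_ae_iff.2 (measure_singleton 0)] with h hh
  rw [fracKernel, mul_assoc, ← Real.rpow_natCast, ← Real.rpow_add (norm_pos_iff.2 hh)]
  congr 2
  push_cast
  ring

theorem integrableOn_ball_fracKernel_mul_sq [NeZero n] (hs : s < 1) (δ : ℝ) :
    IntegrableOn (fun h : Rn n => fracKernel n s ‖h‖ * ‖h‖ ^ 2) (Metric.ball 0 δ) := by
  have hpow := integrableOn_ball_norm_rpow (volume : Measure (Rn n)) (a := 2 - n - 2 * s)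
    (by rw [finrank_euclideanSpace_fin]; linarith) δ
  exact (hpow.const_mul _).congr (ae_restrict_of_ae ((ae_fracKernel_mul_sq_eq s).mono
    fun h hh => hh.symm))

theorem setIntegral_ball_fracKernel_mul_sq [NeZero n] (hs : s ∈ Ioo (0 : ℝ) 1) (hδ : 0 ≤ δ) :
    ∫ h in Metric.ball (0 : Rn n) δ, fracKernel n s ‖h‖ * ‖h‖ ^ 2 =
      fracConstFactor n s * (n * (volume : Measure (Rn n)).real (Metric.ball 0 1) / 4) *
        δ ^ (2 * (1 - s)) := by
  have hs₁ : 1 - s ≠ 0 := (sub_pos.2 hs.2).ne'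
  rw [integral_congr_ae (ae_restrict_of_ae (ae_fracKernel_mul_sq_eq s)), integral_const_mul,
    setIntegral_ball_norm_rpow _ (by rw [finrank_euclideanSpace_fin]; linarith [hs.2]) hδ,
    fracConst_eq hs, finrank_euclideanSpace_fin,
    show (n : ℝ) + (2 - n - 2 * s) = 2 * (1 - s) by ring]
  field_simp
  ring

theorem tendsto_setIntegral_ball_fracKernel_mul_sq [NeZero n] (hδ : 0 < δ) :
    Tendsto (fun s => ∫ h in Metric.ball (0 : Rn n) δ, fracKernel n s ‖h‖ * ‖h‖ ^ 2)
      (𝓝[<] 1) (𝓝 n) := by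
  have hpow : Tendsto (fun s : ℝ => δ ^ (2 * (1 - s))) (𝓝[<] 1) (𝓝 (δ ^ (2 * (1 - 1 : ℝ)))) :=
    ((Real.continuous_const_rpow hδ.ne').comp (by fun_prop : Continuous fun s : ℝ => 2 * (1 - s))
      |>.tendsto 1).mono_left nhdsWithin_le_nhds
  have hlim := ((tendsto_fracConstFactor (n := n)).mul_const
    (n * (volume : Measure (Rn n)).real (Metric.ball 0 1) / 4)).mul hpow
  have hval : 4 * Gamma ((n : ℝ) / 2 + 1) / π ^ ((n : ℝ) / 2) *
      (n * (volume : Measure (Rn n)).real (Metric.ball 0 1) / 4) * δ ^ (2 * (1 - 1 : ℝ)) = n := by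
    have : Gamma ((n : ℝ) / 2 + 1) ≠ 0 := (Gamma_pos_of_pos (by positivity)).ne'
    rw [measureReal_ball_one, sub_self, mul_zero, Real.rpow_zero]
    field_simp
  rw [hval] at hlim
  refine hlim.congr' ?_
  filter_upwards [Ioo_mem_nhdsLT one_pos] with s hs
  exact (setIntegral_ball_fracKernel_mul_sq hs hδ.le).symm

theorem integrableOn_compl_ball_fracKernel [NeZero n] (hs : 0 < s) (hδ : 0 < δ) :
    IntegrableOn (fun h : Rn n => fracKernel n s ‖h‖) (Metric.ball 0 δ)ᶜ :=
  (integrableOn_compl_ball_norm_rpow _ (by rw [finrank_euclideanSpace_fin]; linarith)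
    hδ).const_mul _

theorem setIntegral_compl_ball_fracKernel [NeZero n] (hs : s ∈ Ioo (0 : ℝ) 1) (hδ : 0 < δ) :
    ∫ h in (Metric.ball (0 : Rn n) δ)ᶜ, fracKernel n s ‖h‖ =
      (1 - s) * fracConstFactor n s / 2 *
        (n * (volume : Measure (Rn n)).real (Metric.ball 0 1) * (-δ ^ (-2 * s) / (-2 * s))) := by
  simp only [fracKernel]
  rw [integral_const_mul, setIntegral_compl_ball_norm_rpow _
    (by rw [finrank_euclideanSpace_fin]; linarith [hs.1]) hδ, fracConst_eq hs,
    finrank_euclideanSpace_fin, show (n : ℝ) + (-n - 2 * s) = -2 * s by ring]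

theorem tendsto_setIntegral_compl_ball_fracKernel [NeZero n] (hδ : 0 < δ) :
    Tendsto (fun s => ∫ h in (Metric.ball (0 : Rn n) δ)ᶜ, fracKernel n s ‖h‖)
      (𝓝[<] 1) (𝓝 0) := by
  have hsub : Tendsto (fun s : ℝ => 1 - s) (𝓝[<] 1) (𝓝 0) := by
    have : Tendsto (fun s : ℝ => 1 - s) (𝓝 1) (𝓝 (1 - 1)) := tendsto_const_nhds.sub tendsto_id
    exact (sub_self (1 : ℝ) ▸ this).mono_left nhdsWithin_le_nhds
  have hpow : ContinuousAt (fun s : ℝ => -δ ^ (-2 * s) / (-2 * s)) 1 := by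
    refine ContinuousAt.div (ContinuousAt.neg ?_) (by fun_prop) (by norm_num)
    exact ContinuousAt.rpow (by fun_prop) (by fun_prop) (Or.inl hδ.ne')
  have hlim := ((hsub.mul (tendsto_fracConstFactor (n := n))).div_const 2).mul
    ((hpow.tendsto.mono_left nhdsWithin_le_nhds).const_mul
      (n * (volume : Measure (Rn n)).real (Metric.ball 0 1)))
  rw [zero_mul, zero_div, zero_mul] at hlim
  refine hlim.congr' ?_
  filter_upwards [Ioo_mem_nhdsLT one_pos] with s hs
  exact (setIntegral_compl_ball_fracKernel hs hδ).symm

theorem integrable_fracKernel_mul_min [NeZero n] (hs : s ∈ Ioo (0 : ℝ) 1) :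
    Integrable fun h : Rn n => fracKernel n s ‖h‖ * min 1 (‖h‖ ^ 2) := by
  rw [← integrableOn_univ, ← union_compl_self (Metric.ball (0 : Rn n) 1)]
  refine IntegrableOn.union ?_ ?_
  · refine (integrableOn_ball_fracKernel_mul_sq hs.2 1).congr_fun (fun h hh => ?_)
      Metric.isOpen_ball.measurableSet
    have hle : ‖h‖ ^ 2 ≤ 1 := pow_le_one₀ (norm_nonneg h) (mem_ball_zero_iff.1 hh).le
    simp only [min_eq_right hle]
  · refine (integrableOn_compl_ball_fracKernel hs.1 one_pos).congr_fun (fun h hh => ?_)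
      Metric.isOpen_ball.measurableSet.compl
    have hge : 1 ≤ ‖h‖ ^ 2 := one_le_pow₀ (not_lt.1 fun hlt => hh (mem_ball_zero_iff.2 hlt))
    simp only [min_eq_left hge, mul_one]

end Kernel

section KernelLimit

open Set

variable {n : ℕ} {I : Rn n → ℂ} {A : Matrix (Fin n) (Fin n) ℂ} {s δ ε K : ℝ}

theorem norm_fracKernel_mul (hs : 0 < s) (h : Rn n) (z : ℂ) :
    ‖(fracKernel n s ‖h‖ : ℂ) * z‖ = fracKernel n s ‖h‖ * ‖z‖ := by
  rw [norm_mul, Complex.norm_real, Real.norm_of_nonneg (fracKernel_nonneg hs (norm_nonneg h))]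

theorem aestronglyMeasurable_fracKernel_mul (hI : AEStronglyMeasurable I) (s : ℝ) :
    AEStronglyMeasurable fun h => (fracKernel n s ‖h‖ : ℂ) * I h :=
  (Complex.measurable_ofReal.comp
    ((measurable_fracKernel n s).comp measurable_norm)).aestronglyMeasurable.mul hI

theorem ae_norm_fracKernel_mul_sub_quadForm_le (hs : 0 < s)
    (hA : ∀ h ∈ Metric.ball (0 : Rn n) δ, ‖I h - quadForm A h‖ ≤ ε * ‖h‖ ^ 2) :
    ∀ᵐ h ∂volume.restrict (Metric.ball 0 δ),
      ‖(fracKernel n s ‖h‖ : ℂ) * I h - (fracKernel n s ‖h‖ : ℂ) * quadForm A h‖ ≤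
        ε * (fracKernel n s ‖h‖ * ‖h‖ ^ 2) := by
  refine ae_restrict_of_forall_mem Metric.isOpen_ball.measurableSet fun h hh => ?_
  rw [← mul_sub, norm_fracKernel_mul hs, mul_left_comm]
  exact mul_le_mul_of_nonneg_left (hA h hh) (fracKernel_nonneg hs (norm_nonneg h))

variable [NeZero n]

theorem integrableOn_compl_ball_fracKernel_mul (hs : 0 < s) (hδ : 0 < δ)
    (hI : AEStronglyMeasurable I) (hK : ∀ h, ‖I h‖ ≤ K) :
    IntegrableOn (fun h => (fracKernel n s ‖h‖ : ℂ) * I h) (Metric.ball 0 δ)ᶜ :=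
  (integrableOn_compl_ball_fracKernel hs hδ).ofReal.mul_bdd (c := K) hI.restrict (ae_of_all _ hK)

theorem norm_setIntegral_compl_ball_fracKernel_mul_le (hs : 0 < s) (hδ : 0 < δ)
    (hK : ∀ h, ‖I h‖ ≤ K) :
    ‖∫ h in (Metric.ball 0 δ)ᶜ, (fracKernel n s ‖h‖ : ℂ) * I h‖ ≤
      K * ∫ h in (Metric.ball (0 : Rn n) δ)ᶜ, fracKernel n s ‖h‖ := by
  rw [← integral_const_mul]
  refine norm_integral_le_of_norm_le ((integrableOn_compl_ball_fracKernel hs hδ).const_mul K)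
    (ae_of_all _ fun h => ?_)
  rw [norm_fracKernel_mul hs, mul_comm K]
  exact mul_le_mul_of_nonneg_left (hK h) (fracKernel_nonneg hs (norm_nonneg h))

theorem integrableOn_ball_fracKernel_mul (hs : s ∈ Ioo (0 : ℝ) 1) (hI : AEStronglyMeasurable I)
    (hA : ∀ h ∈ Metric.ball (0 : Rn n) δ, ‖I h - quadForm A h‖ ≤ ε * ‖h‖ ^ 2) :
    IntegrableOn (fun h => (fracKernel n s ‖h‖ : ℂ) * I h) (Metric.ball 0 δ) := by
  have hsq := integrableOn_ball_fracKernel_mul_sq (n := n) hs.2 δ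
  have hQ := integrable_radial_mul_quadForm hsq A
  refine (Integrable.add ?_ hQ).congr (ae_of_all _ fun h => sub_add_cancel _ _)
  exact (hsq.const_mul ε).mono' ((aestronglyMeasurable_fracKernel_mul hI s).restrict.sub hQ.1)
    (ae_norm_fracKernel_mul_sub_quadForm_le hs.1 hA)

theorem norm_setIntegral_ball_fracKernel_mul_sub_le (hs : s ∈ Ioo (0 : ℝ) 1)
    (hI : AEStronglyMeasurable I)
    (hA : ∀ h ∈ Metric.ball (0 : Rn n) δ, ‖I h - quadForm A h‖ ≤ ε * ‖h‖ ^ 2) :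
    ‖(∫ h in Metric.ball 0 δ, (fracKernel n s ‖h‖ : ℂ) * I h) -
      (((∫ h in Metric.ball (0 : Rn n) δ, fracKernel n s ‖h‖ * ‖h‖ ^ 2) / n : ℝ) : ℂ) * A.trace‖ ≤
      ε * ∫ h in Metric.ball (0 : Rn n) δ, fracKernel n s ‖h‖ * ‖h‖ ^ 2 := by
  have hsq := integrableOn_ball_fracKernel_mul_sq (n := n) hs.2 δ
  rw [← integral_radial_mul_quadForm (measurePreserving_restrict_ball · δ) hsq A,
    ← integral_sub (integrableOn_ball_fracKernel_mul hs hI hA)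
      (integrable_radial_mul_quadForm hsq A), ← integral_const_mul]
  exact norm_integral_le_of_norm_le (hsq.const_mul ε)
    (ae_norm_fracKernel_mul_sub_quadForm_le hs.1 hA)

theorem norm_integral_fracKernel_mul_sub_le (hs : s ∈ Ioo (0 : ℝ) 1) (hδ : 0 < δ)
    (hI : AEStronglyMeasurable I) (hK : ∀ h, ‖I h‖ ≤ K)
    (hA : ∀ h ∈ Metric.ball (0 : Rn n) δ, ‖I h - quadForm A h‖ ≤ ε * ‖h‖ ^ 2) :
    ‖(∫ h, (fracKernel n s ‖h‖ : ℂ) * I h) -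
      (((∫ h in Metric.ball (0 : Rn n) δ, fracKernel n s ‖h‖ * ‖h‖ ^ 2) / n : ℝ) : ℂ) * A.trace‖ ≤
      ε * (∫ h in Metric.ball (0 : Rn n) δ, fracKernel n s ‖h‖ * ‖h‖ ^ 2) +
        K * ∫ h in (Metric.ball (0 : Rn n) δ)ᶜ, fracKernel n s ‖h‖ := by
  have hball := integrableOn_ball_fracKernel_mul hs hI hA
  have hcompl := integrableOn_compl_ball_fracKernel_mul hs.1 hδ hI hK
  have hint : Integrable fun h => (fracKernel n s ‖h‖ : ℂ) * I h := by
    rw [← integrableOn_univ, ← union_compl_self (Metric.ball (0 : Rn n) δ)]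
    exact hball.union hcompl
  rw [← integral_add_compl Metric.isOpen_ball.measurableSet hint, add_sub_right_comm]
  exact norm_add_le_of_le (norm_setIntegral_ball_fracKernel_mul_sub_le hs hI hA)
    (norm_setIntegral_compl_ball_fracKernel_mul_le hs.1 hδ hK)

theorem tendsto_integral_fracKernel_mul (hI : AEStronglyMeasurable I) (hK : ∀ h, ‖I h‖ ≤ K)
    (hA : (fun h => I h - quadForm A h) =o[𝓝 0] fun h => ‖h‖ ^ 2) :
    Tendsto (fun s => ∫ h, (fracKernel n s ‖h‖ : ℂ) * I h) (𝓝[<] 1) (𝓝 A.trace) := by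
  have hn : (n : ℝ) ≠ 0 := NeZero.ne _
  rw [Metric.tendsto_nhds]
  intro η hη
  obtain ⟨δ, hδ, hball⟩ := Metric.eventually_nhds_iff_ball.1
    (Asymptotics.isLittleO_iff.1 hA (show 0 < η / (n + 1) by positivity))
  simp only [norm_pow, norm_norm] at hball
  have hmoment := tendsto_setIntegral_ball_fracKernel_mul_sq (n := n) hδ
  have htrace := (((hmoment.div_const (n : ℝ)).ofReal.mul_const A.trace).sub_const A.trace).norm
  rw [div_self hn, Complex.ofReal_one, one_mul, sub_self, norm_zero] at htrace
  have hbound := ((hmoment.const_mul (η / (n + 1))).add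
    ((tendsto_setIntegral_compl_ball_fracKernel (n := n) hδ).const_mul K)).add htrace
  have hlt : η / (n + 1) * n + K * 0 + 0 < η := by
    rw [mul_zero, add_zero, add_zero, div_mul_eq_mul_div, div_lt_iff₀ (by positivity)]
    linarith
  filter_upwards [Ioo_mem_nhdsLT one_pos, hbound.eventually_lt_const hlt] with s hs hlt
  rw [dist_eq_norm]
  exact ((norm_sub_le_norm_sub_add_norm_sub _ _ _).trans (add_le_add
    (norm_integral_fracKernel_mul_sub_le hs hδ hI hK hball) le_rfl)).trans_lt hlt

end KernelLimit

section FractionalGradient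

open Real Set

variable {n : ℕ} {s : ℝ} {γ : Rn n → ℝ} {a u φ : Rn n → ℂ} {G : Rn n → Cn n}

/-- The coefficient of `(u(y) - u(x)) (y - x)` in `∇ˢu(x, y)`, as a function of `r = |y - x|`. -/
def fracGradFactor (n : ℕ) (s r : ℝ) : ℝ :=
  -(√(fracConst n s) / √2) / r ^ ((n : ℝ) / 2 + s + 1)

theorem fracGrad_apply (s : ℝ) (u : Rn n → ℂ) (z : Rn n × Rn n) (i : Fin n) :
    fracGrad s u z i =
      (fracGradFactor n s ‖z.2 - z.1‖ : ℂ) * (u z.2 - u z.1) * (((z.2 - z.1) i : ℝ) : ℂ) := by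
  simp only [fracGrad, fracGradFactor, PiLp.sub_apply]
  push_cast
  ring

theorem fracGrad_add_apply (s : ℝ) (u : Rn n → ℂ) (x h : Rn n) (i : Fin n) :
    fracGrad s u (x, x + h) i = (fracGradFactor n s ‖h‖ : ℂ) * Δ_[h] u x * (h i : ℂ) := by
  rw [fracGrad_apply, add_sub_cancel_left, fwdDiff]

theorem fracGradFactor_sq_mul_sq {r : ℝ} (hs : 0 < s) (hr : 0 < r) :
    fracGradFactor n s r ^ 2 * r ^ 2 = fracKernel n s r := by
  rw [fracGradFactor, fracKernel, div_pow, neg_sq, div_pow, sq_sqrt (fracConst_nonneg hs),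
    sq_sqrt zero_le_two, ← rpow_natCast (r ^ _), ← rpow_mul hr.le, div_mul_eq_mul_div,
    mul_div_assoc, ← rpow_natCast r, ← rpow_sub hr]
  congr 2
  ring

theorem sum_fracGrad_mul_fracGrad (hs : 0 < s) (u φ : Rn n → ℂ) (x h : Rn n) :
    ∑ i, fracGrad s u (x, x + h) i * fracGrad s φ (x, x + h) i =
      (fracKernel n s ‖h‖ : ℂ) * (Δ_[h] u x * Δ_[h] φ x) := by
  rcases eq_or_ne h 0 with rfl | hh
  · simp [fracGrad, fwdDiff]
  · rw [← fracGradFactor_sq_mul_sq hs (norm_pos_iff.2 hh), EuclideanSpace.real_norm_sq_eq]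
    push_cast
    simp only [fracGrad_add_apply, Finset.mul_sum, Finset.sum_mul]
    refine Finset.sum_congr rfl fun i _ => ?_
    ring

theorem norm_fracGrad_sq (hs : 0 < s) (u : Rn n → ℂ) (x h : Rn n) :
    ‖fracGrad s u (x, x + h)‖ ^ 2 = fracKernel n s ‖h‖ * ‖Δ_[h] u x‖ ^ 2 := by
  rw [EuclideanSpace.norm_sq_eq]
  rcases eq_or_ne h 0 with rfl | hh
  · simp [fracGrad, fwdDiff]
  · rw [← fracGradFactor_sq_mul_sq hs (norm_pos_iff.2 hh), EuclideanSpace.real_norm_sq_eq]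
    simp only [fracGrad_add_apply, Finset.mul_sum, Finset.sum_mul, norm_mul, Complex.norm_real,
      mul_pow, norm_eq_abs, sq_abs]
    refine Finset.sum_congr rfl fun i _ => ?_
    ring

theorem aestronglyMeasurable_fracGrad (s : ℝ) (hu : AEStronglyMeasurable u) :
    AEStronglyMeasurable (fracGrad s u) := by
  refine (PiLp.continuous_toLp 2 fun _ : Fin n => ℂ).comp_aestronglyMeasurable
    (g := fun v => WithLp.toLp 2 v) (f := fun z => WithLp.ofLp (fracGrad s u z)) ?_
  refine AEMeasurable.aestronglyMeasurable (aemeasurable_pi_iff.2 fun i => ?_)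
  simp only [fracGrad_apply]
  have hfactor : Measurable fun z : Rn n × Rn n => (fracGradFactor n s ‖z.2 - z.1‖ : ℂ) := by
    unfold fracGradFactor
    fun_prop
  have hcoord : Measurable fun z : Rn n × Rn n => (((z.2 - z.1) i : ℝ) : ℂ) := by fun_prop
  have hdiff : AEStronglyMeasurable (fun z : Rn n × Rn n => u z.2 - u z.1) :=
    AEStronglyMeasurable.sub hu.comp_snd hu.comp_fst
  exact (hfactor.aemeasurable.mul hdiff.aemeasurable).mul hcoord.aemeasurable

theorem measurePreserving_shear :
    MeasurePreserving (MeasurableEquiv.shearAddRight (Rn n)) volume volume :=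
  measurePreserving_prod_add volume volume

theorem lpNorm_two_sq {α E : Type*} [MeasurableSpace α] [NormedAddCommGroup E] {μ : Measure α}
    {f : α → E} (hf : AEStronglyMeasurable f μ) : lpNorm f 2 μ ^ 2 = ∫ x, ‖f x‖ ^ 2 ∂μ := by
  have hnonneg : 0 ≤ ∫ x, ‖f x‖ ^ (2 : ℝ) ∂μ := integral_nonneg fun x => by positivity
  rw [lpNorm_eq_integral_norm_rpow_toReal two_ne_zero ENNReal.ofNat_ne_top hf,
    ENNReal.toReal_ofNat, ← rpow_natCast, ← rpow_mul hnonneg]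
  simp

theorem HasL2Gradient.lpNorm_fwdDiff_sq_le (hu : HasL2Gradient u G) (h : Rn n) :
    lpNorm (Δ_[h] u) 2 volume ^ 2 ≤
      max (2 * lpNorm u 2 volume) (lpNorm G 2 volume) ^ 2 * min 1 (‖h‖ ^ 2) := by
  rcases le_total 1 ‖h‖ with hh | hh
  · rw [min_eq_left (one_le_pow₀ hh), mul_one]
    exact pow_le_pow_left₀ lpNorm_nonneg
      ((lpNorm_fwdDiff_le_two_mul hu.memLp one_le_two h).trans (le_max_left _ _)) 2
  · rw [min_eq_right (pow_le_one₀ (norm_nonneg h) hh), ← mul_pow, mul_comm]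
    refine pow_le_pow_left₀ lpNorm_nonneg ((hu.lpNorm_fwdDiff_le h).trans ?_) 2
    gcongr
    exact le_max_right _ _

theorem memLp_fracGrad [NeZero n] (hs : s ∈ Ioo (0 : ℝ) 1) (hu : HasL2Gradient u G) :
    MemLp (fracGrad s u) 2 := by
  have hmeas := aestronglyMeasurable_fracGrad s hu.memLp.1
  rw [memLp_two_iff_integrable_sq_norm hmeas, ← measurePreserving_shear.integrable_comp_emb
    (MeasurableEquiv.measurableEmbedding _)]
  have hmeas' := (hmeas.comp_measurePreserving measurePreserving_shear).norm.pow 2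
  have hsq (x h : Rn n) : ‖fracGrad s u (x, x + h)‖ ^ 2 =
      fracKernel n s ‖h‖ * ‖Δ_[h] u x‖ ^ 2 := norm_fracGrad_sq hs.1 u x h
  refine (integrable_prod_iff' hmeas').2 ⟨ae_of_all _ fun h => ?_, ?_⟩
  · exact ((memLp_fwdDiff hu.memLp h).integrable_norm_pow two_ne_zero).const_mul
      (fracKernel n s ‖h‖) |>.congr (ae_of_all _ fun x => (hsq x h).symm)
  · refine ((integrable_fracKernel_mul_min hs).const_mul
      (max (2 * lpNorm u 2 volume) (lpNorm G 2 volume) ^ 2)).mono'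
      hmeas'.norm.prod_swap.integral_prod_right' (ae_of_all _ fun h => ?_)
    have hint : ∫ x, ‖‖fracGrad s u (x, x + h)‖ ^ 2‖ =
        fracKernel n s ‖h‖ * lpNorm (Δ_[h] u) 2 volume ^ 2 := by
      rw [lpNorm_two_sq (memLp_fwdDiff hu.memLp h).1, ← integral_const_mul]
      simp only [← hsq, norm_pow, norm_norm]
    have hker := fracKernel_nonneg (n := n) hs.1 (norm_nonneg h)
    refine (congrArg norm hint).trans_le ?_
    rw [norm_of_nonneg (by positivity), mul_left_comm]
    exact mul_le_mul_of_nonneg_left (hu.lpNorm_fwdDiff_sq_le h) hker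

theorem fracFlux_eq_smul (s : ℝ) (γ : Rn n → ℝ) (u : Rn n → ℂ) :
    fracFlux s γ u = fun z => ((√(γ z.1) : ℂ) * (√(γ z.2) : ℂ)) • fracGrad s u z := by
  ext z i
  simp [fracFlux, interactionMatrix, Matrix.smul_mulVec]

theorem memLp_fracFlux (hγ : MemLp (fun x => (√(γ x) : ℂ)) ∞) (hu : MemLp (fracGrad s u) 2) :
    MemLp (fracFlux s γ u) 2 := by
  have hfst : MemLp (fun z : Rn n × Rn n => (√(γ z.1) : ℂ)) ∞ :=
    memLp_top_of_bound hγ.1.comp_fst _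
      (Measure.quasiMeasurePreserving_fst.ae (ae_le_lpNorm_exponent_top hγ))
  have hsnd : MemLp (fun z : Rn n × Rn n => (√(γ z.2) : ℂ)) ∞ :=
    memLp_top_of_bound hγ.1.comp_snd _
      (Measure.quasiMeasurePreserving_snd.ae (ae_le_lpNorm_exponent_top hγ))
  rw [fracFlux_eq_smul]
  exact memLp_fun_smul (memLp_fun_smul hfst hsnd) hu

/-- The contribution of the pairs `(x, x + h)` to the quadratic form of `C^s_γ`, with `a = γ^{1/2}`
and without the singular kernel. -/
def incrementForm (a u φ : Rn n → ℂ) (h : Rn n) : ℂ :=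
  ∫ x, (a x * Δ_[h] u x) * (a (x + h) * Δ_[h] φ x)

theorem aestronglyMeasurable_incrementForm (ha : AEStronglyMeasurable a)
    (hu : AEStronglyMeasurable u) (hφ : AEStronglyMeasurable φ) :
    AEStronglyMeasurable (incrementForm a u φ) := by
  have hadd {f : Rn n → ℂ} (hf : AEStronglyMeasurable f) :
      AEStronglyMeasurable fun z : Rn n × Rn n => f (z.1 + z.2) :=
    (hf.comp_snd : AEStronglyMeasurable (fun z : Rn n × Rn n => f z.2)
      ((volume : Measure (Rn n)).prod volume)).comp_measurePreserving measurePreserving_shear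
  have hdiff {f : Rn n → ℂ} (hf : AEStronglyMeasurable f) :
      AEStronglyMeasurable fun z : Rn n × Rn n => Δ_[z.2] f z.1 := (hadd hf).sub hf.comp_fst
  exact AEStronglyMeasurable.integral_prod_right' (AEStronglyMeasurable.prod_swap
    ((ha.comp_fst.mul (hdiff hu)).mul ((hadd ha).mul (hdiff hφ))))

theorem fracCond_eq_integral (hs : 0 < s) (hu : MemLp (fracFlux s γ u) 2)
    (hφ : MemLp (fracGrad s φ) 2) :
    fracCond s γ u φ =
      ∫ h, (fracKernel n s ‖h‖ : ℂ) * incrementForm (fun x => (√(γ x) : ℂ)) u φ h := by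
  have hint : Integrable fun z : Rn n × Rn n => ∑ i, fracFlux s γ u z i * fracGrad s φ z i :=
    integrable_finsetSum _ fun i _ =>
      (memLp_piLp_iff.1 hu i).integrable_mul (memLp_piLp_iff.1 hφ i)
  have hshear (x h : Rn n) : ∑ i, fracFlux s γ u (x, x + h) i * fracGrad s φ (x, x + h) i =
      (fracKernel n s ‖h‖ : ℂ) * ((√(γ x) * Δ_[h] u x) * (√(γ (x + h)) * Δ_[h] φ x)) := by
    simp only [fracFlux_eq_smul, PiLp.smul_apply, smul_eq_mul, mul_assoc]
    simp only [← Finset.mul_sum, sum_fracGrad_mul_fracGrad hs]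
    ring
  calc fracCond s γ u φ
    _ = ∫ z : Rn n × Rn n, ∑ i, fracFlux s γ u (z.1, z.1 + z.2) i *
          fracGrad s φ (z.1, z.1 + z.2) i := (measurePreserving_shear.integral_comp' _).symm
    _ = ∫ h, ∫ x, ∑ i, fracFlux s γ u (x, x + h) i * fracGrad s φ (x, x + h) i :=
        integral_prod_symm _ (measurePreserving_shear.integrable_comp_of_integrable hint)
    _ = ∫ h, (fracKernel n s ‖h‖ : ℂ) * incrementForm (fun x => (√(γ x) : ℂ)) u φ h := by
        simp only [hshear, integral_const_mul, incrementForm]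

end FractionalGradient

section LocalLimit

open Asymptotics

variable {n : ℕ} {γ : Rn n → ℝ} {a u φ : Rn n → ℂ} {G Φ : Rn n → Cn n}

/-- The matrix of the integrals `∫ a² Gᵢ Φⱼ`; for `G = ∇u` and `Φ = ∇φ` its quadratic form is the
second order part of `incrementForm a u φ` at `h = 0`. -/
def gradMatrix (a : Rn n → ℂ) (G Φ : Rn n → Cn n) : Matrix (Fin n) (Fin n) ℂ :=
  Matrix.of fun i j => ∫ x, (a x * G x i) * (a x * Φ x j)

theorem memLp_mul_apply (ha : MemLp a ∞) (hG : MemLp G 2) (i : Fin n) :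
    MemLp (fun x => a x * G x i) 2 :=
  memLp_fun_smul ha (memLp_piLp_iff.1 hG i)

theorem quadForm_gradMatrix (ha : MemLp a ∞) (hG : MemLp G 2) (hΦ : MemLp Φ 2) (h : Rn n) :
    quadForm (gradMatrix a G Φ) h =
      ∫ x, (a x * realDot h (G x)) * (a x * realDot h (Φ x)) := by
  have hint (i j : Fin n) :
      Integrable fun x => ((h i * h j : ℝ) : ℂ) * ((a x * G x i) * (a x * Φ x j)) :=
    ((memLp_mul_apply ha hG i).integrable_mul (memLp_mul_apply ha hΦ j)).const_mul _
  simp only [quadForm, gradMatrix, Matrix.of_apply, ← integral_const_mul]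
  simp_rw [← integral_finsetSum _ fun j _ => hint _ j]
  rw [← integral_finsetSum _ fun i _ => integrable_finsetSum _ fun j _ => hint i j]
  congr with x
  simp only [realDot_apply, Finset.mul_sum, Finset.sum_mul]
  rw [Finset.sum_comm]
  refine Finset.sum_congr rfl fun i _ => Finset.sum_congr rfl fun j _ => ?_
  push_cast
  ring

theorem trace_gradMatrix (ha : MemLp a ∞) (hG : MemLp G 2) (hΦ : MemLp Φ 2) :
    (gradMatrix a G Φ).trace = ∫ x, ∑ i, (a x * G x i) * (a x * Φ x i) :=
  (integral_finsetSum _ fun i _ =>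
    (memLp_mul_apply ha hG i).integrable_mul (memLp_mul_apply ha hΦ i)).symm

theorem norm_incrementForm_le (ha : MemLp a ∞) (hu : MemLp u 2) (hφ : MemLp φ 2) (h : Rn n) :
    ‖incrementForm a u φ h‖ ≤
      (lpNorm a ∞ volume * (2 * lpNorm u 2 volume)) *
        (lpNorm a ∞ volume * (2 * lpNorm φ 2 volume)) := by
  have hbound {b f : Rn n → ℂ} (hb : MemLp b ∞) (hf : MemLp f 2) :
      lpNorm (fun x => b x * Δ_[h] f x) 2 volume ≤
        lpNorm b ∞ volume * (2 * lpNorm f 2 volume) :=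
    (lpNorm_smul_le hb (memLp_fwdDiff hf h)).trans
      (mul_le_mul_of_nonneg_left (lpNorm_fwdDiff_le_two_mul hf one_le_two h) lpNorm_nonneg)
  have ha' := memLp_comp_add_right ha h
  have hφbound := hbound ha' hφ
  rw [lpNorm_comp_add_right ha] at hφbound
  refine (norm_integral_mul_le_lpNorm_mul_lpNorm (memLp_fun_smul ha (memLp_fwdDiff hu h))
    (memLp_fun_smul ha' (memLp_fwdDiff hφ h))).trans ?_
  exact mul_le_mul (hbound ha hu) hφbound lpNorm_nonneg
    (mul_nonneg lpNorm_nonneg (mul_nonneg zero_le_two lpNorm_nonneg))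

theorem HasL2Gradient.isLittleO_lpNorm_mul_fwdDiff_sub (ha : MemLp a ∞)
    (hu : HasL2Gradient u G) :
    (fun h => lpNorm ((fun x => a x * Δ_[h] u x) - fun x => a x * realDot h (G x)) 2 volume)
      =o[𝓝 0] fun h : Rn n => ‖h‖ := by
  refine IsBigO.trans_isLittleO (.of_norm_le fun h => ?_)
    (hu.isLittleO_lpNorm_fwdDiff_sub_realDot.const_mul_left (lpNorm a ∞ volume))
  have hfactor : ((fun x => a x * Δ_[h] u x) - fun x => a x * realDot h (G x)) =
      fun x => a x • (Δ_[h] u x - realDot h (G x)) := by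
    ext x
    simp only [Pi.sub_apply, smul_eq_mul, mul_sub]
  rw [Real.norm_of_nonneg lpNorm_nonneg, hfactor]
  exact lpNorm_smul_le ha ((memLp_fwdDiff hu.memLp h).sub (memLp_realDot hu.memLp_grad h))

theorem HasL2Gradient.isLittleO_lpNorm_comp_add_mul_fwdDiff_sub (ha : MemLp a ∞)
    (hφ : HasL2Gradient φ Φ) :
    (fun h => lpNorm ((fun x => a (x + h) * Δ_[h] φ x) - fun x => a x * realDot h (Φ x)) 2 volume)
      =o[𝓝 0] fun h : Rn n => ‖h‖ := by
  have htranslate : (fun h : Rn n => ‖h‖ * lpNorm (fun x => Δ_[h] a x • Φ x) 2 volume)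
      =o[𝓝 0] fun h => ‖h‖ := by
    simpa using (isBigO_refl (fun h : Rn n => ‖h‖) _).mul_isLittleO ((isLittleO_one_iff ℝ).2
      (tendsto_lpNorm_fwdDiff_smul ha hφ.memLp_grad one_le_two ENNReal.ofNat_ne_top))
  refine IsBigO.trans_isLittleO (.of_norm_le fun h => ?_)
    ((hφ.isLittleO_lpNorm_fwdDiff_sub_realDot.const_mul_left (lpNorm a ∞ volume)).add htranslate)
  have hsplit : ((fun x => a (x + h) * Δ_[h] φ x) - fun x => a x * realDot h (Φ x)) =
      (fun x => a (x + h) • (Δ_[h] φ x - realDot h (Φ x))) +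
        fun x => realDot h (Δ_[h] a x • Φ x) := by
    ext x
    simp only [Pi.sub_apply, Pi.add_apply, smul_eq_mul, map_smul, fwdDiff]
    ring
  have ha' := memLp_comp_add_right ha h
  have hsub := (memLp_fwdDiff hφ.memLp h).sub (memLp_realDot hφ.memLp_grad h)
  rw [Real.norm_of_nonneg lpNorm_nonneg, hsplit, ← lpNorm_comp_add_right ha h]
  exact (lpNorm_add_le (memLp_fun_smul ha' hsub) one_le_two).trans (add_le_add
    (lpNorm_smul_le ha' hsub)
    (lpNorm_realDot_le (memLp_fun_smul (memLp_fwdDiff ha h) hφ.memLp_grad) h))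

theorem isLittleO_incrementForm_sub_quadForm (ha : MemLp a ∞) (hu : HasL2Gradient u G)
    (hφ : HasL2Gradient φ Φ) :
    (fun h => incrementForm a u φ h - quadForm (gradMatrix a G Φ) h) =o[𝓝 0]
      fun h => ‖h‖ ^ 2 := by
  have hφO : (fun h => lpNorm (fun x => a (x + h) * Δ_[h] φ x) 2 volume) =O[𝓝 0]
      fun h => ‖h‖ := by
    refine .of_bound (lpNorm a ∞ volume * lpNorm Φ 2 volume) (.of_forall fun h => ?_)
    rw [Real.norm_of_nonneg lpNorm_nonneg, norm_norm, mul_assoc, mul_comm (lpNorm Φ 2 volume),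
      ← lpNorm_comp_add_right ha h]
    exact (lpNorm_smul_le (memLp_comp_add_right ha h) (memLp_fwdDiff hφ.memLp h)).trans
      (mul_le_mul_of_nonneg_left (hφ.lpNorm_fwdDiff_le h) lpNorm_nonneg)
  have hGO : (fun h => lpNorm (fun x => a x * realDot h (G x)) 2 volume) =O[𝓝 0]
      fun h => ‖h‖ := by
    refine .of_bound (lpNorm a ∞ volume * lpNorm G 2 volume) (.of_forall fun h => ?_)
    rw [Real.norm_of_nonneg lpNorm_nonneg, norm_norm, mul_assoc, mul_comm (lpNorm G 2 volume)]
    exact (lpNorm_smul_le ha (memLp_realDot hu.memLp_grad h)).trans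
      (mul_le_mul_of_nonneg_left (lpNorm_realDot_le hu.memLp_grad h) lpNorm_nonneg)
  have hsum := ((hu.isLittleO_lpNorm_mul_fwdDiff_sub ha).mul_isBigO hφO).add
    (hGO.mul_isLittleO (hφ.isLittleO_lpNorm_comp_add_mul_fwdDiff_sub ha))
  simp only [← sq] at hsum
  refine IsBigO.trans_isLittleO (.of_norm_le fun h => ?_) hsum
  rw [quadForm_gradMatrix ha hu.memLp_grad hφ.memLp_grad]
  exact norm_integral_mul_sub_integral_mul_le (memLp_fun_smul ha (memLp_fwdDiff hu.memLp h))
    (memLp_fun_smul ha (memLp_realDot hu.memLp_grad h))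
    (memLp_fun_smul (memLp_comp_add_right ha h) (memLp_fwdDiff hφ.memLp h))
    (memLp_fun_smul ha (memLp_realDot hφ.memLp_grad h))

theorem memLp_top_sqrt {α : Type*} [MeasurableSpace α] {μ : Measure α} {f : α → ℝ}
    (hf : MemLp f ∞ μ) : MemLp (fun x => (√(f x) : ℂ)) ∞ μ := by
  have hcont : Continuous fun t : ℝ => (√t : ℂ) := by fun_prop
  refine memLp_top_of_bound (hcont.comp_aestronglyMeasurable hf.1) (√(lpNorm f ∞ μ)) ?_
  filter_upwards [ae_le_lpNorm_exponent_top hf] with x hx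
  rw [Complex.norm_real, Real.norm_of_nonneg (Real.sqrt_nonneg _)]
  exact Real.sqrt_le_sqrt ((le_abs_self _).trans hx)

theorem tendsto_fracCond [NeZero n] (hγ : MemLp γ ∞) (hγ₀ : 0 ≤ᵐ[volume] γ)
    (hu : HasL2Gradient u G) (hφ : HasL2Gradient φ Φ) :
    Tendsto (fun s => fracCond s γ u φ) (𝓝[<] 1)
      (𝓝 (∫ x, ∑ i, ((γ x : ℂ) • G x) i * Φ x i)) := by
  have ha := memLp_top_sqrt hγ
  have hlim := tendsto_integral_fracKernel_mul
    (aestronglyMeasurable_incrementForm ha.1 hu.memLp.1 hφ.memLp.1)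
    (norm_incrementForm_le ha hu.memLp hφ.memLp) (isLittleO_incrementForm_sub_quadForm ha hu hφ)
  have htrace : (gradMatrix (fun x => (√(γ x) : ℂ)) G Φ).trace =
      ∫ x, ∑ i, ((γ x : ℂ) • G x) i * Φ x i := by
    rw [trace_gradMatrix ha hu.memLp_grad hφ.memLp_grad]
    refine integral_congr_ae ?_
    filter_upwards [hγ₀] with x hx
    refine Finset.sum_congr rfl fun i _ => ?_
    rw [mul_mul_mul_comm, ← Complex.ofReal_mul, Real.mul_self_sqrt hx, PiLp.smul_apply,
      smul_eq_mul, mul_assoc]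
  rw [htrace] at hlim
  refine hlim.congr' ?_
  filter_upwards [Ioo_mem_nhdsLT one_pos] with s hs
  exact (fracCond_eq_integral hs.1 (memLp_fracFlux ha (memLp_fracGrad hs hu))
    (memLp_fracGrad hs hφ)).symm

end LocalLimit

end

end FracCond

theorem lemma4p2_general {n : ℕ} [NeZero n] {γ : FracCond.Rn n → ℝ} (hγ : MemLp γ ∞)
    (hγ₀ : 0 ≤ᵐ[volume] γ) {u : FracCond.Rn n → ℂ} (hu : FracCond.MemW 1 2 u) :
    (∀ s ∈ Set.Ioo (0 : ℝ) 1,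
      MemLp (FracCond.fracFlux s γ u) 2 volume ∧
      ∀ φ : 𝓓((⊤ : TopologicalSpace.Opens (FracCond.Rn n)), ℂ),
        MemLp (FracCond.fracGrad s φ) 2 volume) ∧
    ∃ G : FracCond.Rn n → FracCond.Cn n,
      MemLp G 2 volume ∧ FracCond.IsWeakGradient u G ∧
      ∀ φ : 𝓓((⊤ : TopologicalSpace.Opens (FracCond.Rn n)), ℂ),
        Tendsto (fun s : ℝ => FracCond.fracCond s γ u φ) (𝓝[<] 1)
          (𝓝 (-FracCond.distDiv (fun x => ((γ x : ℝ) : ℂ) • G x) φ)) := by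
  obtain ⟨G, hG⟩ := hu.exists_hasL2Gradient
  refine ⟨fun s hs => ⟨?_, fun φ => ?_⟩, G, hG.memLp_grad, hG.isWeakGradient, fun φ => ?_⟩
  · exact FracCond.memLp_fracFlux (FracCond.memLp_top_sqrt hγ) (FracCond.memLp_fracGrad hs hG)
  · exact FracCond.memLp_fracGrad hs (FracCond.hasL2Gradient_testFunction φ)
  · rw [FracCond.distDiv, neg_neg]
    exact FracCond.tendsto_fracCond hγ hγ₀ hG (FracCond.hasL2Gradient_testFunction φ)

theorem lemma4p2 (n : ℕ) (Ω : TopologicalSpace.Opens (FracCond.Rn n))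
    -- the exponent `p = n / (2 s₀)` lies in `(1, ∞)`
    (s₀ : ℝ) (hs₀ : s₀ ∈ Set.Ioo (0 : ℝ) 1) (hn : 2 * s₀ < n)
    (p : ℝ≥0∞) [Fact (1 ≤ p)] (hp : p = ENNReal.ofReal ((n : ℝ) / (2 * s₀)))
    (γ : FracCond.Rn n → ℝ) (hγ : Measurable γ)
    (γlow γup : ℝ) (hlow : 0 < γlow) (hbd : ∀ᵐ x, γlow ≤ γ x ∧ γ x ≤ γup)
    (hm : FracCond.MemWc Ω 2 p (fun x => ((Real.sqrt (γ x) - 1 : ℝ) : ℂ)))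
    (u : FracCond.Rn n → ℂ) (hu : FracCond.MemW 2 2 u) :
    -- for every `s`, the operator is well defined as a pairing of `L²(ℝ²ⁿ)` functions
    (∀ s ∈ Set.Ioo (0 : ℝ) 1,
      MemLp (FracCond.fracFlux s γ u) 2 volume ∧
      ∀ φ : 𝓓((⊤ : TopologicalSpace.Opens (FracCond.Rn n)), ℂ),
        MemLp (FracCond.fracGrad s φ) 2 volume) ∧
    -- `C^s_γ u → -∇·(γ∇u)` in the sense of distributions, with `G = ∇u`
    ∃ G : FracCond.Rn n → FracCond.Cn n,
      MemLp G 2 volume ∧ FracCond.IsWeakGradient u G ∧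
      ∀ φ : 𝓓((⊤ : TopologicalSpace.Opens (FracCond.Rn n)), ℂ),
        Tendsto (fun s : ℝ => FracCond.fracCond s γ u φ) (𝓝[<] 1)
          (𝓝 (-FracCond.distDiv (fun x => ((γ x : ℝ) : ℂ) • G x) φ)) := by
  have : NeZero n := ⟨by rintro rfl; linarith [hs₀.1, Nat.cast_zero (R := ℝ)]⟩
  have hγ_nonneg : 0 ≤ᵐ[volume] γ := hbd.mono fun x hx => hlow.le.trans hx.1
  have hγ_top : MemLp γ ∞ := memLp_top_of_bound hγ.aestronglyMeasurable γup <| by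
    filter_upwards [hbd, hγ_nonneg] with x hx hx₀
    exact (Real.norm_of_nonneg hx₀).trans_le hx.2
  obtain ⟨hu₂, hu⟩ := hu
  exact lemma4p2_general hγ_top hγ_nonneg ⟨hu₂, hu.mono (by norm_num)⟩
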